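/- Let $M$ be a smooth $n$-dimensional manifold with $n$ smooth, everywhere linearly independent global vector fields $\lambda_i$ ($i=1,\dots,n$). In a chart let $\lambda_i{}^{\mu}$ be their components, and $\lambda_{i\mu}$ the components of the dual 1-forms, so that $\lambda_i{}^{\mu}\lambda_{i\nu}=\delta^\mu_\nu$ (repeated indices, including $i$, are summed; a comma denotes a partial derivative). Put $\lambda=\det(\lambda_{i\mu})$, let $g_{\mu\nu}=\lambda_{i\mu}\lambda_{i\nu}$ be the metric, with Levi-Civita symbols $\{{}^{\alpha}_{\mu\nu}\}$, and let $$\Gamma^\alpha{}_{\mu\nu}=\lambda_i{}^{\alpha}\lambda_{i\mu,\nu},\qquad \gamma^\alpha{}_{\mu\nu}=\Gamma^\alpha{}_{\mu\nu}-\{{}^{\alpha}_{\mu\nu}\}$$ be the Weitzenböck connection and its contortion. For $b\in\mathbb R$ let $\nabla^\alpha{}_{\mu\nu}=\{{}^{\alpha}_{\mu\nu}\}+b\,\gamma^\alpha{}_{\mu\nu}$ be the parameterized canonical connection and $\widetilde\nabla^\alpha{}_{\mu\nu}=\nabla^\alpha{}_{\nu\mu}$ its dual. Write $$A_{\mu\|+\nu}=A_{\mu,\nu}-A_\alpha\nabla^\alpha{}_{\mu\nu},\qquad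 T^\mu{}_{\nu\|-\sigma}=T^\mu{}_{\nu,\sigma}+T^\alpha{}_\nu\widetilde\nabla^\mu{}_{\alpha\sigma}-T^\mu{}_\alpha\widetilde\nabla^\alpha{}_{\nu\sigma}.$$ Let $L=L(\lambda_{i\mu},\lambda_{i\mu,\nu},\lambda_{i\mu,\nu\sigma})$ be a smooth real function, defined on an open set of arrays with $\det(\lambda_{i\mu})\neq0$ that contains the arrays of the given $\lambda_{i\mu}$ at all points of the chart, and invariant under coordinate changes: $L$ takes the same value on the components of a tetrad (and their first and second partial derivatives) at a point in any two coordinate systems, wherever both values are defined. With the scalar density $\mathcal L=\lambda L$ define the Hamiltonian derivative $$\frac{\delta L}{\delta\lambda_{i\beta}}=\frac1\lambda\left[\frac{\partial\mathcal L}{\partial\lambda_{i\beta}}-\frac{\partial}{\partial x^\gamma}\left(\frac{\partial\mathcal L}{\partial\lambda_{i\beta,\gamma}}\right)+\frac{\partial^2}{\partial x^\gamma\partial x^\sigma}\left(\frac{\partial\mathcal L}{\partial\lambda_{i\beta,\gamma\sigma}}\right)\right]$$ (the entries $\lambda_{i\beta,\gamma\sigma}$ being treated as independent variables), and $$E^\mu{}_\nu=\frac{\delta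 L}{\delta\lambda_{i\mu}}\lambda_{i\nu},\qquad J_i{}^\mu=-\frac{\delta L}{\delta\lambda_{i\mu}}.$$ Then in every chart, at every point and for every $\nu$, the identity $$E^\mu{}_{\nu\|-\mu}+\lambda_{i\mu\|+\nu}\,J_i{}^\mu=0$$ holds; rewritten in terms of the contortion, it reads $$E^\mu{}_{\nu\|-\mu}=(1-b)\,E^{\mu\alpha}\gamma_{\alpha\mu\nu},\qquad E^{\mu\alpha}=g^{\alpha\beta}E^\mu{}_\beta,\quad \gamma_{\alpha\mu\nu}=g_{\alpha\beta}\gamma^\beta{}_{\mu\nu}.$$ -/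

import Mathlib

open scoped Manifold ContDiff Topology

noncomputable section

namespace PAP

/-- Coordinate space `ℝⁿ`. -/
abbrev Coord (n : ℕ) : Type := EuclideanSpace ℝ (Fin n)

/-- Arrays `(λ_{iμ}, λ_{iμ,ν}, λ_{iμ,νσ})`, the arguments of a Lagrangian function. The last slot is
not required to be symmetric in `ν, σ`, so that all its entries are independent variables. A function
given only on symmetric arrays is covered by composing it with the symmetrization in `ν, σ`; the
Hamiltonian derivative below depends only on the restriction to symmetric arrays. -/
abbrev Jet (n : ℕ) : Type :=
  (Fin n → Fin n → ℝ) × (Fin n → Fin n → Fin n → ℝ) × (Fin n → Fin n → Fin n → Fin n → ℝ)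

/-- A covariant tetrad in coordinates: `lam i μ x` is `λ_{iμ}(x)`. -/
abbrev Tetrad (n : ℕ) : Type := Fin n → Fin n → Coord n → ℝ

variable {n : ℕ}

/-- The partial derivative `∂f/∂x^μ`. -/
def pd (μ : Fin n) (f : Coord n → ℝ) : Coord n → ℝ :=
  fun x => fderiv ℝ f x (EuclideanSpace.single μ 1)

/-- The array of values and first and second partial derivatives of a tetrad at `x`. -/
def jet (lam : Tetrad n) (x : Coord n) : Jet n :=
  (fun i μ => lam i μ x, fun i μ ν => pd ν (lam i μ) x, fun i μ ν σ => pd σ (pd ν (lam i μ)) x)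

/-- The determinant of the undifferentiated entries of an array. -/
def jetDet (J : Jet n) : ℝ := (Matrix.of J.1).det

/-! ### Scalar Lagrangian functions -/

/-- The tetrad in the new coordinates, for a coordinate change `x = ψ(x̄)`:
`λ̄_{iμ}(x̄) = (∂x^ν/∂x̄^μ) λ_{iν}(ψ(x̄))`. -/
def changeCoord (ψ : Coord n → Coord n) (lam : Tetrad n) : Tetrad n :=
  fun i μ y => ∑ ν, pd μ (fun z => ψ z ν) y * lam i ν (ψ y)

/-- `L`, with domain of definition `D`, is invariant under coordinate changes: it takes the same
value on the components of a tetrad in two coordinate systems. A map `ψ` that is smooth near `y` with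
invertible derivative at `y` is a coordinate change near `y`. -/
def CoordInvariant (D : Set (Jet n)) (L : Jet n → ℝ) : Prop :=
  ∀ (ψ : Coord n → Coord n) (lam : Tetrad n) (y : Coord n),
    (∀ᶠ z in 𝓝 y, ContDiffAt ℝ ∞ ψ z) →
    (fderiv ℝ ψ y).det ≠ 0 →
    (∀ i μ, ∀ᶠ z in 𝓝 (ψ y), ContDiffAt ℝ ∞ (lam i μ) z) →
    jet lam (ψ y) ∈ D →
    jet (changeCoord ψ lam) y ∈ D →
    L (jet (changeCoord ψ lam) y) = L (jet lam (ψ y))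

/-- The Lagrangian density `λ L`, with `λ = det (λ_{iμ})`. -/
def density (L : Jet n → ℝ) (J : Jet n) : ℝ := jetDet J * L J

/-- `∂F/∂λ_{iβ}`. -/
def dJet0 (F : Jet n → ℝ) (i β : Fin n) (J : Jet n) : ℝ :=
  fderiv ℝ F J (Pi.single i (Pi.single β 1), 0, 0)

/-- `∂F/∂λ_{iβ,γ}`. -/
def dJet1 (F : Jet n → ℝ) (i β γ : Fin n) (J : Jet n) : ℝ :=
  fderiv ℝ F J (0, Pi.single i (Pi.single β (Pi.single γ 1)), 0)

/-- `∂F/∂λ_{iβ,γσ}`. -/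
def dJet2 (F : Jet n → ℝ) (i β γ σ : Fin n) (J : Jet n) : ℝ :=
  fderiv ℝ F J (0, 0, Pi.single i (Pi.single β (Pi.single γ (Pi.single σ 1))))

/-- The Hamiltonian derivative `δL/δλ_{iβ}` at the tetrad `lam`. -/
def hamiltonDeriv (L : Jet n → ℝ) (lam : Tetrad n) (i β : Fin n) (x : Coord n) : ℝ :=
  1 / jetDet (jet lam x) *
    (dJet0 (density L) i β (jet lam x)
      - ∑ γ, pd γ (fun y => dJet1 (density L) i β γ (jet lam y)) x
      + ∑ γ, ∑ σ, pd γ (pd σ (fun y => dJet2 (density L) i β γ σ (jet lam y))) x)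

/-! ### Absolute parallelism and its parameterized version -/

/-- The contravariant components `λ_i^μ`, determined by `∑ i, λ_i^μ λ_{iν} = δ^μ_ν`. -/
def contra (lam : Tetrad n) (i μ : Fin n) (x : Coord n) : ℝ :=
  (Matrix.of fun j ν => lam j ν x)⁻¹ μ i

/-- The metric `g_{μν} = λ_{iμ} λ_{iν}`. -/
def metric (lam : Tetrad n) (μ ν : Fin n) (x : Coord n) : ℝ := ∑ i, lam i μ x * lam i ν x

/-- The inverse metric `g^{μν}`. -/
def metricInv (lam : Tetrad n) (μ ν : Fin n) (x : Coord n) : ℝ :=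
  (Matrix.of fun α β => metric lam α β x)⁻¹ μ ν

/-- The Levi-Civita connection `{α; μ ν}`. -/
def christoffel (lam : Tetrad n) (α μ ν : Fin n) (x : Coord n) : ℝ :=
  1 / 2 * ∑ σ, metricInv lam α σ x *
    (pd ν (metric lam μ σ) x + pd μ (metric lam ν σ) x - pd σ (metric lam μ ν) x)

/-- The Weitzenböck connection `Γ^α_{μν} = λ_i^α λ_{iμ,ν}`. -/
def weitzenbock (lam : Tetrad n) (α μ ν : Fin n) (x : Coord n) : ℝ :=
  ∑ i, contra lam i α x * pd ν (lam i μ) x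

/-- The contortion `γ^α_{μν}`: the Weitzenböck connection minus the Levi-Civita connection. -/
def contortion (lam : Tetrad n) (α μ ν : Fin n) (x : Coord n) : ℝ :=
  weitzenbock lam α μ ν x - christoffel lam α μ ν x

/-- The contortion with all indices down, `γ_{αμν} = g_{αβ} γ^β_{μν}`. -/
def contortionLow (lam : Tetrad n) (α μ ν : Fin n) (x : Coord n) : ℝ :=
  ∑ β, metric lam α β x * contortion lam β μ ν x

/-- The parameterized canonical connection `∇^α_{μν} = {α; μ ν} + b γ^α_{μν}`. -/
def conn (b : ℝ) (lam : Tetrad n) (α μ ν : Fin n) (x : Coord n) : ℝ :=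
  christoffel lam α μ ν x + b * contortion lam α μ ν x

/-- The parameterized dual connection, the transpose of the canonical one. -/
def connDual (b : ℝ) (lam : Tetrad n) (α μ ν : Fin n) (x : Coord n) : ℝ :=
  conn b lam α ν μ x

/-- The covariant derivative `A_{μ‖+ν}` of a covariant vector with respect to the parameterized
canonical connection. -/
def covPlus (b : ℝ) (lam : Tetrad n) (A : Fin n → Coord n → ℝ) (μ ν : Fin n) (x : Coord n) : ℝ :=
  pd ν (A μ) x - ∑ α, A α x * conn b lam α μ ν x

/-- The covariant derivative `T^μ_{ν‖−σ}` of a mixed tensor with respect to the parameterized dual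
connection; `T μ ν` is the component with `μ` up and `ν` down. -/
def covMinus (b : ℝ) (lam : Tetrad n) (T : Fin n → Fin n → Coord n → ℝ)
    (μ ν σ : Fin n) (x : Coord n) : ℝ :=
  pd σ (T μ ν) x + ∑ α, T α ν x * connDual b lam μ α σ x - ∑ α, T μ α x * connDual b lam α ν σ x

/-- `E^μ_ν = (δL/δλ_{iμ}) λ_{iν}`. -/
def fieldE (L : Jet n → ℝ) (lam : Tetrad n) (μ ν : Fin n) (x : Coord n) : ℝ :=
  ∑ i, hamiltonDeriv L lam i μ x * lam i ν x

/-- `E^{μα} = g^{αβ} E^μ_β`. -/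
def fieldEUp (L : Jet n → ℝ) (lam : Tetrad n) (μ α : Fin n) (x : Coord n) : ℝ :=
  ∑ β, metricInv lam α β x * fieldE L lam μ β x

/-- `J_i^μ = - δL/δλ_{iμ}`. -/
def fieldJ (L : Jet n → ℝ) (lam : Tetrad n) (i μ : Fin n) (x : Coord n) : ℝ :=
  - hamiltonDeriv L lam i μ x

/-! ### AP-spaces -/

/-- `X` is a parallelization of `M`: `n` smooth, everywhere independent global vector fields on an
`n`-dimensional manifold. -/
structure IsParallelization {M : Type*} [TopologicalSpace M] [ChartedSpace (Coord n) M]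
    [IsManifold (𝓡 n) ∞ M] (X : Fin n → (p : M) → TangentSpace (𝓡 n) p) : Prop where
  smooth : ∀ i, ContMDiff (𝓡 n) (𝓡 n).tangent ∞
    (fun p => (⟨p, X i p⟩ : TangentBundle (𝓡 n) M))
  linearIndependent : ∀ p, LinearIndependent ℝ (fun i => X i p)

/-- The components `λ_i^μ` of the vector fields in the chart `φ`, at the point with coordinates `x`. -/
def frameComp {M : Type*} [TopologicalSpace M] [ChartedSpace (Coord n) M]
    (X : Fin n → (p : M) → TangentSpace (𝓡 n) p) (φ : OpenPartialHomeomorph M (Coord n))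
    (i μ : Fin n) (x : Coord n) : ℝ :=
  (show Coord n from mfderiv (𝓡 n) (𝓡 n) φ (φ.symm x) (X i (φ.symm x))) μ

/-- The components `λ_{iμ}` of the dual 1-forms in the chart `φ`, determined by
`∑ i, λ_i^μ λ_{iν} = δ^μ_ν`. -/
def tetrad {M : Type*} [TopologicalSpace M] [ChartedSpace (Coord n) M]
    (X : Fin n → (p : M) → TangentSpace (𝓡 n) p) (φ : OpenPartialHomeomorph M (Coord n)) :
    Tetrad n :=
  fun i μ x => (Matrix.of fun j ν => frameComp X φ j ν x)⁻¹ μ i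

end PAP

end

namespace PAP

open MeasureTheory

variable {n : ℕ}

/-! ### Partial derivatives -/

/-! This is Noether's second theorem for coordinate changes, followed by a trace computation for the
connections. Write P^{iβ} = λ δL/δλ_{iβ} for the Euler-Lagrange expression of λL. For a test
function ϕ, deform the coordinates by y ↦ y + tϕ(y)e_a. To first order in t the tetrad changes by
its Lie derivative ϕ λ_{iμ,a} + ϕ_{,μ} λ_{ia}. Differentiating the invariance of L at t = 0
(`fderiv_lagrangian_lieDeriv`) and adding the variation of the determinant shows that λL changes by
∂_a(λLϕ) (`fderiv_density_lieDeriv`), whose integral vanishes. By the first variation formula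
(`integral_fderiv_jet`) the same integral is that of P^{iβ}(ϕ λ_{iβ,a} + ϕ_{,β} λ_{ia}). One more
integration by parts and the arbitrariness of ϕ give ∂_β(P^{iβ} λ_{ia}) = P^{iβ} λ_{iβ,a}
(`noether_identity`). The connections now enter through two facts. The trace ∇^α_{αν} is ∂_ν log|λ|
for every b (`sum_conn_self`), so dividing the identity by λ turns its left side into the divergence
part of E^μ_{ν‖−μ}. The tetrad is parallel for the Weitzenböck connection, so λ_{iμ‖+ν} = (1-b)
λ_{iα} γ^α_{μν} (`covPlus_tetrad`), which accounts for the remaining terms. -/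

lemma differentiableAt_of_contDiffOn {E F : Type*} [NormedAddCommGroup E] [NormedSpace ℝ E]
    [NormedAddCommGroup F] [NormedSpace ℝ F] {U : Set E} (hU : IsOpen U) {f : E → F}
    (hf : ContDiffOn ℝ ∞ f U) {x : E} (hx : x ∈ U) : DifferentiableAt ℝ f x :=
  (hf.contDiffAt (hU.mem_nhds hx)).differentiableAt (by simp)

lemma contDiffOn_fderiv_apply {E F : Type*} [NormedAddCommGroup E] [NormedSpace ℝ E]
    [NormedAddCommGroup F] [NormedSpace ℝ F] {U : Set E} (hU : IsOpen U) {f : E → F}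
    (hf : ContDiffOn ℝ ∞ f U) (v : E) : ContDiffOn ℝ ∞ (fun x => fderiv ℝ f x v) U :=
  (hf.fderiv_of_isOpen hU (m := ∞) (by simp)).clm_apply contDiffOn_const

lemma contDiffOn_pd {U : Set (Coord n)} (hU : IsOpen U) {f : Coord n → ℝ}
    (hf : ContDiffOn ℝ ∞ f U) (μ : Fin n) : ContDiffOn ℝ ∞ (pd μ f) U :=
  contDiffOn_fderiv_apply hU hf _

lemma pd_congr {f g : Coord n → ℝ} {x : Coord n} (h : f =ᶠ[𝓝 x] g) (μ : Fin n) :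
    pd μ f x = pd μ g x := by
  simp only [pd, h.fderiv_eq]

lemma pd_eventuallyEq {f g : Coord n → ℝ} {x : Coord n} (h : f =ᶠ[𝓝 x] g) (μ : Fin n) :
    pd μ f =ᶠ[𝓝 x] pd μ g := by
  filter_upwards [h.eventuallyEq_nhds] with y hy using pd_congr hy μ

lemma pd_mul {f g : Coord n → ℝ} {x : Coord n} (hf : DifferentiableAt ℝ f x)
    (hg : DifferentiableAt ℝ g x) (μ : Fin n) :
    pd μ (fun y => f y * g y) x = pd μ f x * g x + f x * pd μ g x := by
  simp [pd, fderiv_fun_mul hf hg]; ring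

lemma pd_sum {ι : Type*} (s : Finset ι) {f : ι → Coord n → ℝ} {x : Coord n}
    (hf : ∀ i ∈ s, DifferentiableAt ℝ (f i) x) (μ : Fin n) :
    pd μ (fun y => ∑ i ∈ s, f i y) x = ∑ i ∈ s, pd μ (f i) x := by
  simp [pd, fderiv_fun_sum hf]

/-! ### Test functions and integration by parts -/

/-- Smooth functions with compact support inside `U`. -/
structure IsTest (U : Set (Coord n)) (g : Coord n → ℝ) : Prop where
  smooth : ContDiff ℝ ∞ g
  compact : HasCompactSupport g
  supp : tsupport g ⊆ U

namespace IsTest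

variable {U : Set (Coord n)} {f g : Coord n → ℝ}

/-- The factor `f` is uncontrolled outside `U`, but there the product vanishes locally, so it is
smooth everywhere. -/
lemma mul_left (hg : IsTest U g) (hU : IsOpen U) (hf : ContDiffOn ℝ ∞ f U) :
    IsTest U (fun x => f x * g x) where
  smooth := by
    rw [contDiff_iff_contDiffAt]
    intro x
    by_cases hx : x ∈ tsupport g
    · exact (hf.contDiffAt (hU.mem_nhds (hg.supp hx))).mul hg.smooth.contDiffAt
    · refine contDiffAt_const (c := (0 : ℝ)) |>.congr_of_eventuallyEq ?_
      filter_upwards [notMem_tsupport_iff_eventuallyEq.1 hx] with y hy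
      simp [hy]
  compact := hg.compact.mul_left
  supp := (tsupport_mul_subset_right (f := f) (g := g)).trans hg.supp

lemma pd (hg : IsTest U g) (μ : Fin n) : IsTest U (pd μ g) where
  smooth := contDiffOn_univ.1 (contDiffOn_pd isOpen_univ hg.smooth.contDiffOn μ)
  compact := hg.compact.fderiv_apply ℝ _
  supp := (tsupport_fderiv_apply_subset ℝ _).trans hg.supp

lemma add (hf : IsTest U f) (hg : IsTest U g) : IsTest U (fun x => f x + g x) where
  smooth := hf.smooth.add hg.smooth
  compact := hf.compact.add hg.compact
  supp := (tsupport_add f g).trans (Set.union_subset hf.supp hg.supp)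

lemma integrable (hg : IsTest U g) : Integrable g :=
  hg.smooth.continuous.integrable_of_hasCompactSupport hg.compact

lemma eq_zero (hg : IsTest U g) {x : Coord n} (hx : x ∉ U) : g x = 0 :=
  image_eq_zero_of_notMem_tsupport fun h => hx (hg.supp h)

lemma integral_mul_pd (hg : IsTest U g) (hU : IsOpen U) (hf : ContDiffOn ℝ ∞ f U) (μ : Fin n) :
    ∫ x, f x * PAP.pd μ g x = -∫ x, PAP.pd μ f x * g x :=
  integral_mul_fderiv_eq_neg_fderiv_mul_of_integrable
    (hg.mul_left hU (contDiffOn_pd hU hf μ)).integrable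
    ((hg.pd μ).mul_left hU hf).integrable (hg.mul_left hU hf).integrable
    (fun _ hx => differentiableAt_of_contDiffOn hU hf (hg.supp hx))
    (fun _ _ => hg.smooth.differentiable (by simp) _)

lemma integral_pd (hg : IsTest U g) (μ : Fin n) : ∫ x, PAP.pd μ g x = 0 := by
  have hg' : IsTest Set.univ g := ⟨hg.smooth, hg.compact, Set.subset_univ _⟩
  have := hg'.integral_mul_pd isOpen_univ (f := fun _ => 1) contDiffOn_const μ
  simpa [PAP.pd] using this

end IsTest

/-- Fundamental lemma of the calculus of variations: vanishing almost everywhere on `U` becomes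
vanishing everywhere by continuity. -/
lemma eq_zero_of_integral_mul_test {U : Set (Coord n)} (hU : IsOpen U) {f : Coord n → ℝ}
    (hf : ContDiffOn ℝ ∞ f U) (h : ∀ g, IsTest U g → ∫ x, f x * g x = 0) :
    ∀ x ∈ U, f x = 0 := by
  have h1 := hU.ae_eq_zero_of_integral_contDiff_smul_eq_zero (μ := volume)
    (hf.continuousOn.locallyIntegrableOn hU.measurableSet) (fun g h1 h2 h3 => by
      rw [← h g ⟨h1, h2, h3⟩]
      exact integral_congr_ae (.of_forall fun x => by simp [mul_comm]))
  have h2 : f =ᵐ[volume.restrict U] 0 := (ae_restrict_iff' hU.measurableSet).2 h1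
  exact Measure.eqOn_open_of_ae_eq h2 hU hf.continuousOn continuousOn_const

/-! ### The derivative of the determinant -/

/-- Jacobi's formula: by Cramer's rule each determinant with a replaced row pairs that row with the
adjugate, which is det A · A⁻¹. -/
lemma sum_det_updateRow (A : Matrix (Fin n) (Fin n) ℝ) (B : Fin n → Fin n → ℝ) (hA : A.det ≠ 0) :
    ∑ i, (A.updateRow i (B i)).det = A.det * ∑ i, ∑ μ, A⁻¹ μ i * B i μ := by
  rw [Finset.mul_sum]
  refine Finset.sum_congr rfl fun i _ => ?_
  rw [← Matrix.cramer_transpose_apply, Matrix.cramer_eq_adjugate_mulVec, ← Matrix.adjugate_transpose,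
    Matrix.mulVec, dotProduct, Finset.mul_sum]
  refine Finset.sum_congr rfl fun μ _ => ?_
  rw [Matrix.transpose_apply, Matrix.inv_def, Matrix.smul_apply, Ring.inverse_eq_inv', smul_eq_mul]
  field_simp

/-- The determinant as a continuous multilinear function of the rows. -/
noncomputable def detRows (n : ℕ) :
    ContinuousMultilinearMap ℝ (fun _ : Fin n => (Fin n → ℝ)) ℝ where
  toMultilinearMap := (Matrix.detRowAlternating (R := ℝ) (n := Fin n)).toMultilinearMap
  cont := by
    change Continuous fun A : Fin n → Fin n → ℝ => (Matrix.of A).det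
    exact Continuous.matrix_det continuous_id

lemma contDiff_det : ContDiff ℝ ∞ fun A : Fin n → Fin n → ℝ => (Matrix.of A).det :=
  (detRows n).contDiff

lemma fderiv_det (A B : Fin n → Fin n → ℝ) (hA : (Matrix.of A).det ≠ 0) :
    fderiv ℝ (fun A : Fin n → Fin n → ℝ => (Matrix.of A).det) A B =
      (Matrix.of A).det * ∑ i, ∑ μ, (Matrix.of A)⁻¹ μ i * B i μ := by
  have h : HasFDerivAt (fun A : Fin n → Fin n → ℝ => (Matrix.of A).det)
      ((detRows n).linearDeriv A) A := (detRows n).hasFDerivAt A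
  rw [h.fderiv, ContinuousMultilinearMap.linearDeriv_apply]
  exact sum_det_updateRow _ B hA

lemma contDiff_jetDet : ContDiff ℝ ∞ (jetDet (n := n)) :=
  contDiff_det.comp contDiff_fst

lemma fderiv_jetDet (J K : Jet n) (hJ : jetDet J ≠ 0) :
    fderiv ℝ jetDet J K = jetDet J * ∑ i, ∑ μ, (Matrix.of J.1)⁻¹ μ i * K.1 i μ := by
  rw [show (jetDet : Jet n → ℝ) = (fun A : Fin n → Fin n → ℝ => (Matrix.of A).det) ∘ Prod.fst from
    rfl, fderiv_comp _ (contDiff_det.differentiable (by simp) _) differentiableAt_fst]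
  simpa [fderiv_fst] using fderiv_det J.1 K.1 hJ

/-- By Cramer's rule an entry of the inverse is a quotient of determinants, the numerator having row
`i` replaced by a unit vector. -/
lemma contDiffOn_inv_apply {E : Type*} [NormedAddCommGroup E] [NormedSpace ℝ E] {U : Set E}
    {A : Fin n → Fin n → E → ℝ} (hA : ∀ i μ, ContDiffOn ℝ ∞ (A i μ) U)
    (hdet : ∀ x ∈ U, (Matrix.of fun i μ => A i μ x).det ≠ 0) (μ i : Fin n) :
    ContDiffOn ℝ ∞ (fun x => (Matrix.of fun i μ => A i μ x)⁻¹ μ i) U := by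
  have hd : ∀ B : Fin n → Fin n → E → ℝ, (∀ i μ, ContDiffOn ℝ ∞ (B i μ) U) →
      ContDiffOn ℝ ∞ (fun x => (Matrix.of fun i μ => B i μ x).det) U := fun B hB =>
    contDiff_det.comp_contDiffOn (contDiffOn_pi.2 fun i => contDiffOn_pi.2 fun μ => hB i μ)
  have h1 := hd (fun j ν => if j = i then fun _ => Pi.single (M := fun _ => ℝ) μ 1 ν else A j ν)
    (fun j ν => by split_ifs; exacts [contDiffOn_const, hA j ν])
  refine ((hd A hA).inv hdet |>.mul h1).congr fun x hx => ?_
  rw [Matrix.inv_def, Matrix.smul_apply, Ring.inverse_eq_inv', smul_eq_mul, Matrix.adjugate_apply]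
  congr 2
  ext j ν
  by_cases h : j = i <;> simp [Matrix.updateRow_apply, h]

/-! ### Jets -/

lemma contDiffOn_jet {U : Set (Coord n)} (hU : IsOpen U) {lam : Tetrad n}
    (h : ∀ i μ, ContDiffOn ℝ ∞ (lam i μ) U) : ContDiffOn ℝ ∞ (jet lam) U := by
  refine ContDiffOn.prodMk ?_ (ContDiffOn.prodMk ?_ ?_)
  · exact contDiffOn_pi.2 fun i => contDiffOn_pi.2 fun μ => h i μ
  · exact contDiffOn_pi.2 fun i => contDiffOn_pi.2 fun μ => contDiffOn_pi.2 fun ν =>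
      contDiffOn_pd hU (h i μ) ν
  · exact contDiffOn_pi.2 fun i => contDiffOn_pi.2 fun μ => contDiffOn_pi.2 fun ν =>
      contDiffOn_pi.2 fun σ => contDiffOn_pd hU (contDiffOn_pd hU (h i μ) ν) σ

lemma map_pi_single {ι E : Type*} [Fintype ι] [DecidableEq ι] [AddCommGroup E] [Module ℝ E]
    (l : (ι → E) →ₗ[ℝ] ℝ) (v : ι → E) : l v = ∑ i, l (Pi.single i (v i)) := by
  conv_lhs => rw [← Finset.univ_sum_single v, map_sum]

lemma map_pi_single_real {ι : Type*} [Fintype ι] [DecidableEq ι]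
    (l : (ι → ℝ) →ₗ[ℝ] ℝ) (v : ι → ℝ) : l v = ∑ i, l (Pi.single i 1) * v i := by
  rw [map_pi_single]
  refine Finset.sum_congr rfl fun i _ => ?_
  rw [mul_comm, ← smul_eq_mul, ← map_smul, ← Pi.single_smul, smul_eq_mul, mul_one]

/-- Expansion of a linear form in the standard basis. No factors 1/2 occur because the entries with
indices γσ and σγ are independent variables. -/
lemma fderiv_jet_apply (F : Jet n → ℝ) (J K : Jet n) :
    fderiv ℝ F J K = ∑ i, ∑ β, (dJet0 F i β J * K.1 i β
      + ∑ γ, dJet1 F i β γ J * K.2.1 i β γ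
      + ∑ γ, ∑ σ, dJet2 F i β γ σ J * K.2.2 i β γ σ) := by
  obtain ⟨k0, k1, k2⟩ := K
  set l : Jet n →ₗ[ℝ] ℝ := (fderiv ℝ F J).toLinearMap with hl
  have h0 : l (k0, 0, 0) = ∑ i, ∑ β, dJet0 F i β J * k0 i β := by
    change (l ∘ₗ LinearMap.inl ℝ _ _) k0 = _
    rw [map_pi_single]
    refine Finset.sum_congr rfl fun i _ => ?_
    rw [← LinearMap.coe_single (R := ℝ), ← LinearMap.comp_apply, map_pi_single_real]
    rfl
  have h1 : l (0, k1, 0) = ∑ i, ∑ β, ∑ γ, dJet1 F i β γ J * k1 i β γ := by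
    change (l ∘ₗ LinearMap.inr ℝ _ _ ∘ₗ LinearMap.inl ℝ _ _) k1 = _
    rw [map_pi_single]
    refine Finset.sum_congr rfl fun i _ => ?_
    rw [← LinearMap.coe_single (R := ℝ), ← LinearMap.comp_apply, map_pi_single]
    refine Finset.sum_congr rfl fun β _ => ?_
    rw [← LinearMap.coe_single (R := ℝ), ← LinearMap.comp_apply, map_pi_single_real]
    rfl
  have h2 : l (0, 0, k2) = ∑ i, ∑ β, ∑ γ, ∑ σ, dJet2 F i β γ σ J * k2 i β γ σ := by
    change (l ∘ₗ LinearMap.inr ℝ _ _ ∘ₗ LinearMap.inr ℝ _ _) k2 = _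
    rw [map_pi_single]
    refine Finset.sum_congr rfl fun i _ => ?_
    rw [← LinearMap.coe_single (R := ℝ), ← LinearMap.comp_apply, map_pi_single]
    refine Finset.sum_congr rfl fun β _ => ?_
    rw [← LinearMap.coe_single (R := ℝ), ← LinearMap.comp_apply, map_pi_single]
    refine Finset.sum_congr rfl fun γ _ => ?_
    rw [← LinearMap.coe_single (R := ℝ), ← LinearMap.comp_apply, map_pi_single_real]
    rfl
  have hs : ((k0, k1, k2) : Jet n) = (k0, 0, 0) + (0, k1, 0) + (0, 0, k2) := by simp
  change l (k0, k1, k2) = _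
  rw [hs, map_add, map_add, h0, h1, h2]
  simp only [Finset.sum_add_distrib, Prod.mk_add_mk, add_zero, zero_add]

/-! ### Infinitesimal coordinate changes -/

/-- The coordinate basis vector. -/
noncomputable abbrev basisVec (a : Fin n) : Coord n := EuclideanSpace.single a 1

/-- The coordinate change `y ↦ y + t ϕ(y) e_a`. -/
noncomputable def shift (ϕ : Coord n → ℝ) (a : Fin n) (t : ℝ) (y : Coord n) : Coord n :=
  y + (t * ϕ y) • basisVec a

/-- The Lie derivative of the tetrad along the vector field `ϕ e_a`. -/
noncomputable def lieDeriv (ϕ : Coord n → ℝ) (a : Fin n) (lam : Tetrad n) : Tetrad n :=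
  fun i μ y => ϕ y * pd a (lam i μ) y + pd μ ϕ y * lam i a y

/-- The tetrad in the coordinates given by `shift ϕ a t`, as a function of `t` and the point. -/
noncomputable def shifted (ϕ : Coord n → ℝ) (a : Fin n) (lam : Tetrad n) (i μ : Fin n)
    (p : ℝ × Coord n) : ℝ :=
  lam i μ (shift ϕ a p.1 p.2) + p.1 * pd μ ϕ p.2 * lam i a (shift ϕ a p.1 p.2)

section

variable {ϕ : Coord n → ℝ} {a : Fin n} {lam : Tetrad n} {U : Set (Coord n)}

lemma shift_zero (y : Coord n) : shift ϕ a 0 y = y := by simp [shift]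

lemma contDiff_shift_uncurry (hϕ : ContDiff ℝ ∞ ϕ) :
    ContDiff ℝ ∞ fun p : ℝ × Coord n => shift ϕ a p.1 p.2 :=
  contDiff_snd.add ((contDiff_fst.mul (hϕ.comp contDiff_snd)).smul contDiff_const)

lemma contDiff_shift (hϕ : ContDiff ℝ ∞ ϕ) (t : ℝ) : ContDiff ℝ ∞ (shift ϕ a t) :=
  contDiff_id.add ((contDiff_const.mul hϕ).smul contDiff_const)

lemma hasFDerivAt_shift (hϕ : ContDiff ℝ ∞ ϕ) (t : ℝ) (y : Coord n) :
    HasFDerivAt (shift ϕ a t) (ContinuousLinearMap.id ℝ (Coord n) +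
      (t • fderiv ℝ ϕ y).smulRight (basisVec a)) y :=
  (hasFDerivAt_id y).add
    (((hϕ.differentiable (by simp) y).hasFDerivAt.const_mul t).smul_const (basisVec a))

lemma pd_shift (hϕ : ContDiff ℝ ∞ ϕ) (t : ℝ) (μ ν : Fin n) (y : Coord n) :
    pd μ (fun z => shift ϕ a t z ν) y =
      (if ν = μ then 1 else 0) + t * pd μ ϕ y * (if ν = a then 1 else 0) := by
  have h := (EuclideanSpace.proj (𝕜 := ℝ) ν).hasFDerivAt.comp y
    (hasFDerivAt_shift (a := a) hϕ t y)
  have h' : HasFDerivAt (fun z => shift ϕ a t z ν) _ y := h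
  rw [pd, h'.fderiv]
  simp [pd, basisVec]

lemma changeCoord_shift (hϕ : ContDiff ℝ ∞ ϕ) (t : ℝ) (i μ : Fin n) (y : Coord n) :
    changeCoord (shift ϕ a t) lam i μ y = shifted ϕ a lam i μ (t, y) := by
  simp [changeCoord, shifted, pd_shift hϕ, add_mul, Finset.sum_add_distrib, mul_assoc]

lemma isOpen_shift_preimage (hϕ : ContDiff ℝ ∞ ϕ) (hU : IsOpen U) :
    IsOpen {p : ℝ × Coord n | shift ϕ a p.1 p.2 ∈ U} :=
  hU.preimage (contDiff_shift_uncurry hϕ).continuous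

/-- Since `lam` is smooth only on `U`, joint smoothness in time and point holds on the open set
where the shifted point lies in `U`. -/
lemma contDiffOn_shifted (hϕ : ContDiff ℝ ∞ ϕ) (h : ∀ i μ, ContDiffOn ℝ ∞ (lam i μ) U)
    (i μ : Fin n) :
    ContDiffOn ℝ ∞ (shifted ϕ a lam i μ) {p : ℝ × Coord n | shift ϕ a p.1 p.2 ∈ U} := by
  have hs : ∀ j κ, ContDiffOn ℝ ∞ (fun p : ℝ × Coord n => lam j κ (shift ϕ a p.1 p.2))
      {p : ℝ × Coord n | shift ϕ a p.1 p.2 ∈ U} := fun j κ =>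
    (h j κ).comp (contDiff_shift_uncurry hϕ).contDiffOn fun _ hp => hp
  have hp : ContDiff ℝ ∞ (pd μ ϕ) :=
    contDiffOn_univ.1 (contDiffOn_pd isOpen_univ hϕ.contDiffOn μ)
  exact (hs i μ).add ((contDiff_fst.mul (hp.comp contDiff_snd)).contDiffOn.mul (hs i a))

end

/-! ### Time and space derivatives of functions on ℝ × ℝⁿ -/

section

variable {W : Set (ℝ × Coord n)} {f : ℝ × Coord n → ℝ}

lemma pd_slice {t : ℝ} {y : Coord n} (hf : DifferentiableAt ℝ f (t, y)) (ν : Fin n) :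
    pd ν (fun z => f (t, z)) y = fderiv ℝ f (t, y) (0, basisVec ν) := by
  have h : HasFDerivAt (fun z => f (t, z)) _ y :=
    hf.hasFDerivAt.comp y (hasFDerivAt_prodMk_right t y)
  rw [pd, h.fderiv]
  rfl

lemma hasDerivAt_slice {t : ℝ} {y : Coord n} (hf : DifferentiableAt ℝ f (t, y)) :
    HasDerivAt (fun s => f (s, y)) (fderiv ℝ f (t, y) (1, 0)) t := by
  have h : HasFDerivAt (fun s => f (s, y)) _ t :=
    hf.hasFDerivAt.comp t (hasFDerivAt_prodMk_left t y)
  simpa using h.hasDerivAt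

lemma slice_eventually (hW : IsOpen W) {t : ℝ} {y : Coord n} (hp : (t, y) ∈ W) :
    ∀ᶠ z in 𝓝 y, (t, z) ∈ W :=
  (Continuous.prodMk_right t).continuousAt.preimage_mem_nhds (hW.mem_nhds hp)

lemma pd_pd_slice (hW : IsOpen W) (hf : ContDiffOn ℝ ∞ f W) {t : ℝ} {y : Coord n}
    (hp : (t, y) ∈ W) (ν σ : Fin n) :
    pd σ (pd ν fun z => f (t, z)) y =
      fderiv ℝ (fun q => fderiv ℝ f q (0, basisVec ν)) (t, y) (0, basisVec σ) := by
  rw [← pd_slice (differentiableAt_of_contDiffOn hW (contDiffOn_fderiv_apply hW hf _) hp)]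
  refine pd_congr ?_ σ
  filter_upwards [slice_eventually hW hp] with z hz
    using pd_slice (differentiableAt_of_contDiffOn hW hf hz) ν

lemma fderiv_fderiv_comm (hW : IsOpen W) (hf : ContDiffOn ℝ ∞ f W) {p : ℝ × Coord n}
    (hp : p ∈ W) (v w : ℝ × Coord n) :
    fderiv ℝ (fun q => fderiv ℝ f q v) p w = fderiv ℝ (fun q => fderiv ℝ f q w) p v := by
  have hd : DifferentiableAt ℝ (fderiv ℝ f) p :=
    differentiableAt_of_contDiffOn hW (hf.fderiv_of_isOpen hW (m := ∞) (by simp)) hp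
  have hs : IsSymmSndFDerivAt ℝ f p :=
    (hf.contDiffAt (hW.mem_nhds hp)).isSymmSndFDerivAt (by
      rw [minSmoothness_of_isRCLikeNormedField]
      exact WithTop.coe_le_coe.2 (le_top : (2 : ℕ∞) ≤ ⊤))
  rw [fderiv_clm_apply hd (differentiableAt_const _), fderiv_clm_apply hd (differentiableAt_const _)]
  simpa using hs w v

/-- Two uses of the symmetry of second derivatives. With `w` the time direction, it lets the time
derivative be taken before both space derivatives. -/
lemma fderiv_fderiv_fderiv_comm (hW : IsOpen W) (hf : ContDiffOn ℝ ∞ f W) {p : ℝ × Coord n}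
    (hp : p ∈ W) (u v w : ℝ × Coord n) :
    fderiv ℝ (fun r => fderiv ℝ (fun q => fderiv ℝ f q u) r v) p w =
      fderiv ℝ (fun r => fderiv ℝ (fun q => fderiv ℝ f q w) r u) p v := by
  rw [fderiv_fderiv_comm hW (contDiffOn_fderiv_apply hW hf u) hp v w]
  have h : (fun r => fderiv ℝ (fun q => fderiv ℝ f q u) r w) =ᶠ[𝓝 p]
      fun r => fderiv ℝ (fun q => fderiv ℝ f q w) r u := by
    filter_upwards [hW.mem_nhds hp] with r hr using fderiv_fderiv_comm hW hf hr u w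
  rw [h.fderiv_eq]

end

section

variable {ϕ : Coord n → ℝ} {a : Fin n} {lam : Tetrad n} {U : Set (Coord n)}

lemma fderiv_shifted (hϕ : ContDiff ℝ ∞ ϕ) (hU : IsOpen U)
    (h : ∀ i μ, ContDiffOn ℝ ∞ (lam i μ) U) (i μ : Fin n) {y : Coord n} (hy : y ∈ U) :
    fderiv ℝ (shifted ϕ a lam i μ) (0, y) (1, 0) = lieDeriv ϕ a lam i μ y := by
  have hd := hasDerivAt_slice (differentiableAt_of_contDiffOn (isOpen_shift_preimage hϕ hU)
    (contDiffOn_shifted (a := a) hϕ h i μ) (x := (0, y)) (by simpa [shift_zero] using hy))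
  refine hd.unique ?_
  have hs : HasDerivAt (fun t => shift ϕ a t y) (ϕ y • basisVec a) 0 := by
    simpa [shift] using (((hasDerivAt_id (0 : ℝ)).mul_const (ϕ y)).smul_const
      (basisVec a)).const_add y
  have hl : ∀ j κ, HasDerivAt (fun t => lam j κ (shift ϕ a t y)) (ϕ y * pd a (lam j κ) y) 0 := by
    intro j κ
    have h1 : HasFDerivAt (lam j κ) (fderiv ℝ (lam j κ) y) (shift ϕ a 0 y) := by
      rw [shift_zero]
      exact (differentiableAt_of_contDiffOn hU (h j κ) hy).hasFDerivAt
    have h2 : HasDerivAt (fun t => lam j κ (shift ϕ a t y)) _ 0 := h1.comp_hasDerivAt 0 hs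
    simpa [pd] using h2
  have : HasDerivAt (fun t => shifted ϕ a lam i μ (t, y)) _ 0 :=
    (hl i μ).add (((hasDerivAt_id (0 : ℝ)).mul_const (pd μ ϕ y)).mul (hl i a))
  simpa [shifted, lieDeriv, shift_zero] using this

/-- Time and space derivatives commute, so the derivative of the jet is the jet of the derivative,
and `fderiv_shifted` identifies the latter near `y`. -/
lemma hasDerivAt_jet_changeCoord (hϕ : ContDiff ℝ ∞ ϕ) (hU : IsOpen U)
    (h : ∀ i μ, ContDiffOn ℝ ∞ (lam i μ) U) {y : Coord n} (hy : y ∈ U) :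
    HasDerivAt (fun t => jet (changeCoord (shift ϕ a t) lam) y) (jet (lieDeriv ϕ a lam) y) 0 := by
  set W : Set (ℝ × Coord n) := {p | shift ϕ a p.1 p.2 ∈ U} with hWdef
  have hW : IsOpen W := isOpen_shift_preimage hϕ hU
  have hf : ∀ i μ, ContDiffOn ℝ ∞ (shifted ϕ a lam i μ) W := contDiffOn_shifted hϕ h
  have hyW : ((0 : ℝ), y) ∈ W := by simpa [hWdef, shift_zero] using hy
  have hlie : ∀ i μ, (fun z => fderiv ℝ (shifted ϕ a lam i μ) (0, z) (1, 0)) =ᶠ[𝓝 y]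
      lieDeriv ϕ a lam i μ := fun i μ => by
    filter_upwards [hU.mem_nhds hy] with z hz using fderiv_shifted hϕ hU h i μ hz
  have hc : ∀ t i μ, changeCoord (shift ϕ a t) lam i μ = fun z => shifted ϕ a lam i μ (t, z) :=
    fun t i μ => funext fun z => changeCoord_shift hϕ t i μ z
  have ht : ∀ᶠ t : ℝ in 𝓝 0, (t, y) ∈ W :=
    (Continuous.prodMk_left y).continuousAt.preimage_mem_nhds (hW.mem_nhds hyW)
  refine HasDerivAt.prodMk ?_ (HasDerivAt.prodMk ?_ ?_)
  · refine hasDerivAt_pi.2 fun i => hasDerivAt_pi.2 fun μ => ?_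
    simp only [hc]
    have := hasDerivAt_slice (differentiableAt_of_contDiffOn hW (hf i μ) hyW)
    rwa [fderiv_shifted hϕ hU h i μ hy] at this
  · refine hasDerivAt_pi.2 fun i => hasDerivAt_pi.2 fun μ => hasDerivAt_pi.2 fun ν => ?_
    simp only [hc]
    have := hasDerivAt_slice (differentiableAt_of_contDiffOn hW
      (contDiffOn_fderiv_apply hW (hf i μ) (0, basisVec ν)) hyW)
    rw [fderiv_fderiv_comm hW (hf i μ) hyW, ← pd_slice (differentiableAt_of_contDiffOn hW
      (contDiffOn_fderiv_apply hW (hf i μ) _) hyW), pd_congr (hlie i μ)] at this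
    refine this.congr_of_eventuallyEq ?_
    filter_upwards [ht] with t ht
      using pd_slice (differentiableAt_of_contDiffOn hW (hf i μ) ht) ν
  · refine hasDerivAt_pi.2 fun i => hasDerivAt_pi.2 fun μ => hasDerivAt_pi.2 fun ν =>
      hasDerivAt_pi.2 fun σ => ?_
    simp only [hc]
    have := hasDerivAt_slice (differentiableAt_of_contDiffOn hW (contDiffOn_fderiv_apply hW
      (contDiffOn_fderiv_apply hW (hf i μ) (0, basisVec ν)) (0, basisVec σ)) hyW)
    rw [fderiv_fderiv_fderiv_comm hW (hf i μ) hyW, ← pd_pd_slice hW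
      (contDiffOn_fderiv_apply hW (hf i μ) _) hyW, pd_congr (pd_eventuallyEq (hlie i μ) ν)] at this
    refine this.congr_of_eventuallyEq ?_
    filter_upwards [ht] with t ht using pd_pd_slice hW (hf i μ) ht ν σ

/-- The infinitesimal form of coordinate invariance. -/
lemma fderiv_lagrangian_lieDeriv {D : Set (Jet n)} (hD : IsOpen D) {L : Jet n → ℝ}
    (hL : ContDiffOn ℝ ∞ L D) (hinv : CoordInvariant D L) (hϕ : ContDiff ℝ ∞ ϕ) (hU : IsOpen U)
    (h : ∀ i μ, ContDiffOn ℝ ∞ (lam i μ) U) (hdom : ∀ x ∈ U, jet lam x ∈ D)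
    {y : Coord n} (hy : y ∈ U) :
    fderiv ℝ L (jet lam y) (jet (lieDeriv ϕ a lam) y) =
      ϕ y * pd a (fun x => L (jet lam x)) y := by
  have hLd : DifferentiableAt ℝ L (jet lam y) := differentiableAt_of_contDiffOn hD hL (hdom y hy)
  have hjet := hasDerivAt_jet_changeCoord (a := a) hϕ hU h hy
  have hz : jet (changeCoord (shift ϕ a 0) lam) y = jet lam y := by
    have : changeCoord (shift ϕ a 0) lam = lam := by
      funext i μ z
      simp [changeCoord_shift hϕ, shifted, shift_zero]
    rw [this]
  have h1 : HasDerivAt (fun t => L (jet (changeCoord (shift ϕ a t) lam) y))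
      (fderiv ℝ L (jet lam y) (jet (lieDeriv ϕ a lam) y)) 0 := by
    refine HasFDerivAt.comp_hasDerivAt 0 ?_ hjet
    rw [hz]
    exact hLd.hasFDerivAt
  have hs : HasDerivAt (fun t => shift ϕ a t y) (ϕ y • basisVec a) 0 := by
    simpa [shift] using (((hasDerivAt_id (0 : ℝ)).mul_const (ϕ y)).smul_const
      (basisVec a)).const_add y
  have h2 : HasDerivAt (fun t => L (jet lam (shift ϕ a t y)))
      (ϕ y * pd a (fun x => L (jet lam x)) y) 0 := by
    have h3 : HasFDerivAt (fun x => L (jet lam x)) (fderiv ℝ (fun x => L (jet lam x)) y)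
        (shift ϕ a 0 y) := by
      rw [shift_zero]
      exact (differentiableAt_of_contDiffOn hU
        (hL.comp (contDiffOn_jet hU h) fun x hx => hdom x hx) hy).hasFDerivAt
    simpa [pd, Function.comp_def] using h3.comp_hasDerivAt 0 hs
  -- Both curves agree for small t by invariance. It suffices that the shift be a local coordinate
  -- change at `y`: its Jacobian is 1 at t = 0, hence nonzero nearby.
  refine h1.unique (h2.congr_of_eventuallyEq ?_)
  have e1 : ∀ᶠ t : ℝ in 𝓝 0, jet (changeCoord (shift ϕ a t) lam) y ∈ D :=
    hjet.continuousAt.preimage_mem_nhds (by rw [hz]; exact hD.mem_nhds (hdom y hy))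
  have e2 : ∀ᶠ t : ℝ in 𝓝 0, shift ϕ a t y ∈ U :=
    hs.continuousAt.preimage_mem_nhds (by rw [shift_zero]; exact hU.mem_nhds hy)
  have e3 : ∀ᶠ t : ℝ in 𝓝 0, (fderiv ℝ (shift ϕ a t) y).det ≠ 0 := by
    have hc : Continuous fun t : ℝ => (fderiv ℝ (shift ϕ a t) y).det := by
      simp only [fun t => (hasFDerivAt_shift (a := a) hϕ t y).fderiv]
      refine ContinuousLinearMap.continuous_det.comp ?_
      fun_prop
    refine hc.continuousAt.eventually_ne ?_
    rw [(hasFDerivAt_shift (a := a) hϕ 0 y).fderiv]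
    simp [ContinuousLinearMap.det]
  filter_upwards [e1, e2, e3] with t t1 t2 t3
  exact hinv (shift ϕ a t) lam y (.of_forall fun z => (contDiff_shift hϕ t).contDiffAt) t3
    (fun i μ => by
      filter_upwards [hU.mem_nhds t2] with z hz using (h i μ).contDiffAt (hU.mem_nhds hz))
    (hdom _ t2) t1

end

/-! ### Dual frames and the determinant -/

section

variable {lam : Tetrad n} {U : Set (Coord n)} {x : Coord n}

lemma sum_contra_mul (hdet : jetDet (jet lam x) ≠ 0) (μ ν : Fin n) :
    ∑ i, contra lam i μ x * lam i ν x = if μ = ν then 1 else 0 := by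
  have h : (Matrix.of fun j ν => lam j ν x)⁻¹ * (Matrix.of fun j ν => lam j ν x) = 1 :=
    Matrix.nonsing_inv_mul _ (isUnit_iff_ne_zero.2 hdet)
  simpa [Matrix.mul_apply, Matrix.one_apply, contra] using congrFun (congrFun h μ) ν

lemma sum_mul_contra (hdet : jetDet (jet lam x) ≠ 0) (i j : Fin n) :
    ∑ μ, lam i μ x * contra lam j μ x = if i = j then 1 else 0 := by
  have h : (Matrix.of fun j ν => lam j ν x) * (Matrix.of fun j ν => lam j ν x)⁻¹ = 1 :=
    Matrix.mul_nonsing_inv _ (isUnit_iff_ne_zero.2 hdet)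
  simpa [Matrix.mul_apply, Matrix.one_apply, contra] using congrFun (congrFun h i) j

lemma pd_jetDet (hU : IsOpen U) (h : ∀ i μ, ContDiffOn ℝ ∞ (lam i μ) U) (hx : x ∈ U)
    (hdet : jetDet (jet lam x) ≠ 0) (a : Fin n) :
    pd a (fun y => jetDet (jet lam y)) x =
      jetDet (jet lam x) * ∑ i, ∑ μ, contra lam i μ x * pd a (lam i μ) x := by
  have hd : ∀ i μ, HasFDerivAt (lam i μ) (fderiv ℝ (lam i μ) x) x := fun i μ =>
    (differentiableAt_of_contDiffOn hU (h i μ) hx).hasFDerivAt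
  have hm : HasFDerivAt (fun y => fun i μ => lam i μ y)
      (ContinuousLinearMap.pi fun i => ContinuousLinearMap.pi fun μ => fderiv ℝ (lam i μ) x) x :=
    hasFDerivAt_pi.2 fun i => hasFDerivAt_pi.2 fun μ => hd i μ
  have hc := (contDiff_det.differentiable (by simp) fun i μ => lam i μ x).hasFDerivAt.comp x hm
  have hc' : HasFDerivAt (fun y => jetDet (jet lam y)) _ x := hc
  rw [pd, hc'.fderiv]
  exact fderiv_det (fun i μ => lam i μ x) _ hdet

end

/-! ### The Lagrangian density -/

section

variable {lam : Tetrad n} {U : Set (Coord n)} {D : Set (Jet n)} {L : Jet n → ℝ}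

lemma contDiffOn_density (hL : ContDiffOn ℝ ∞ L D) : ContDiffOn ℝ ∞ (density L) D :=
  contDiff_jetDet.contDiffOn.mul hL

/-- A density of weight one has a total derivative as its Lie derivative: L contributes ϕ ∂_a L,
while λ contributes ϕ ∂_a λ + λ ∂_a ϕ, the last term coming from λ_i^μ λ_{ia} = δ^μ_a. -/
lemma fderiv_density_lieDeriv (hD : IsOpen D) (hdet : ∀ J ∈ D, jetDet J ≠ 0)
    (hL : ContDiffOn ℝ ∞ L D) (hinv : CoordInvariant D L) {ϕ : Coord n → ℝ}
    (hϕ : ContDiff ℝ ∞ ϕ) (a : Fin n) (hU : IsOpen U)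
    (h : ∀ i μ, ContDiffOn ℝ ∞ (lam i μ) U) (hdom : ∀ x ∈ U, jet lam x ∈ D)
    {x : Coord n} (hx : x ∈ U) :
    fderiv ℝ (density L) (jet lam x) (jet (lieDeriv ϕ a lam) x) =
      pd a (fun y => density L (jet lam y) * ϕ y) x := by
  have hne : jetDet (jet lam x) ≠ 0 := hdet _ (hdom x hx)
  have hjet := contDiffOn_jet hU h
  have d1 : DifferentiableAt ℝ (fun y => jetDet (jet lam y)) x :=
    differentiableAt_of_contDiffOn hU (contDiff_jetDet.comp_contDiffOn hjet) hx
  have d2 : DifferentiableAt ℝ (fun y => L (jet lam y)) x :=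
    differentiableAt_of_contDiffOn hU (hL.comp hjet fun y hy => hdom y hy) hx
  have d3 : DifferentiableAt ℝ ϕ x := hϕ.differentiable (by simp) x
  have e : ∑ i, ∑ μ, contra lam i μ x * (pd μ ϕ x * lam i a x) = pd a ϕ x := by
    rw [Finset.sum_comm]
    have : ∀ μ, ∑ i, contra lam i μ x * (pd μ ϕ x * lam i a x) =
        pd μ ϕ x * if μ = a then 1 else 0 := fun μ => by
      rw [← sum_contra_mul hne, Finset.mul_sum]
      exact Finset.sum_congr rfl fun i _ => by ring
    simp [this]
  have hl : fderiv ℝ jetDet (jet lam x) (jet (lieDeriv ϕ a lam) x) =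
      ϕ x * pd a (fun y => jetDet (jet lam y)) x + jetDet (jet lam x) * pd a ϕ x := by
    rw [fderiv_jetDet _ _ hne, pd_jetDet hU h hx hne, ← e]
    change jetDet (jet lam x) * ∑ i, ∑ μ, contra lam i μ x *
      (ϕ x * pd a (lam i μ) x + pd μ ϕ x * lam i a x) = _
    simp only [mul_add, Finset.sum_add_distrib, Finset.mul_sum]
    congr 1
    exact Finset.sum_congr rfl fun i _ => Finset.sum_congr rfl fun μ _ => by ring
  have hF : fderiv ℝ (density L) (jet lam x) = _ :=
    fderiv_fun_mul (contDiff_jetDet.differentiable (by simp) (jet lam x))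
      (differentiableAt_of_contDiffOn hD hL (hdom x hx))
  simp only [density]
  rw [hF, pd_mul (d1.fun_mul d2) d3, pd_mul d1 d2]
  simp only [add_apply, smul_apply, smul_eq_mul, hl,
    fderiv_lagrangian_lieDeriv hD hL hinv hϕ hU h hdom hx]
  ring

/-- The Euler-Lagrange expression of the density, `λ δL/δλ_{iβ}`. -/
noncomputable def eulerLagrange (F : Jet n → ℝ) (lam : Tetrad n) (i β : Fin n) (x : Coord n) : ℝ :=
  dJet0 F i β (jet lam x) - ∑ γ, pd γ (fun y => dJet1 F i β γ (jet lam y)) x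
    + ∑ γ, ∑ σ, pd γ (pd σ (fun y => dJet2 F i β γ σ (jet lam y))) x

section

variable {F : Jet n → ℝ}

lemma contDiffOn_fderiv_jet (hD : IsOpen D) (hF : ContDiffOn ℝ ∞ F D) (hU : IsOpen U)
    (h : ∀ i μ, ContDiffOn ℝ ∞ (lam i μ) U) (hdom : ∀ x ∈ U, jet lam x ∈ D) (v : Jet n) :
    ContDiffOn ℝ ∞ (fun x => fderiv ℝ F (jet lam x) v) U :=
  (contDiffOn_fderiv_apply hD hF v).comp (contDiffOn_jet hU h) fun x hx => hdom x hx

lemma contDiffOn_eulerLagrange (hD : IsOpen D) (hF : ContDiffOn ℝ ∞ F D) (hU : IsOpen U)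
    (h : ∀ i μ, ContDiffOn ℝ ∞ (lam i μ) U) (hdom : ∀ x ∈ U, jet lam x ∈ D) (i β : Fin n) :
    ContDiffOn ℝ ∞ (eulerLagrange F lam i β) U := by
  have hv := contDiffOn_fderiv_jet hD hF hU h hdom
  exact ((hv _).sub (ContDiffOn.sum fun γ _ => contDiffOn_pd hU (hv _) γ)).add
    (ContDiffOn.sum fun γ _ => ContDiffOn.sum fun σ _ =>
      contDiffOn_pd hU (contDiffOn_pd hU (hv _) σ) γ)

lemma integrable_fun_sub {f g : Coord n → ℝ} (hf : Integrable f) (hg : Integrable g) :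
    Integrable fun x => f x - g x :=
  hf.sub hg

/-- The first variation formula for compactly supported variations. -/
lemma integral_fderiv_jet (hD : IsOpen D) (hF : ContDiffOn ℝ ∞ F D) (hU : IsOpen U)
    (h : ∀ i μ, ContDiffOn ℝ ∞ (lam i μ) U) (hdom : ∀ x ∈ U, jet lam x ∈ D)
    {η : Tetrad n} (hη : ∀ i μ, IsTest U (η i μ)) :
    ∫ x, fderiv ℝ F (jet lam x) (jet η x) =
      ∑ i, ∑ β, ∫ x, eulerLagrange F lam i β x * η i β x := by
  have hv := contDiffOn_fderiv_jet hD hF hU h hdom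
  simp only [fderiv_jet_apply]
  have i0 : ∀ i β, Integrable fun x => dJet0 F i β (jet lam x) * η i β x := fun i β =>
    ((hη i β).mul_left hU (hv _)).integrable
  have i1 : ∀ i β γ, Integrable fun x => dJet1 F i β γ (jet lam x) * pd γ (η i β) x :=
    fun i β γ => (((hη i β).pd γ).mul_left hU (hv _)).integrable
  have i2 : ∀ i β γ σ, Integrable fun x =>
      dJet2 F i β γ σ (jet lam x) * pd σ (pd γ (η i β)) x :=
    fun i β γ σ => ((((hη i β).pd γ).pd σ).mul_left hU (hv _)).integrable
  have s1 : ∀ i β, Integrable fun x => ∑ γ, dJet1 F i β γ (jet lam x) * pd γ (η i β) x :=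
    fun i β => integrable_finsetSum _ fun γ _ => i1 i β γ
  have s2 : ∀ i β, Integrable fun x =>
      ∑ γ, ∑ σ, dJet2 F i β γ σ (jet lam x) * pd σ (pd γ (η i β)) x :=
    fun i β => integrable_finsetSum _ fun γ _ => integrable_finsetSum _ fun σ _ => i2 i β γ σ
  have j1 : ∀ i β γ, Integrable fun x =>
      pd γ (fun y => dJet1 F i β γ (jet lam y)) x * η i β x := fun i β γ =>
    ((hη i β).mul_left hU (contDiffOn_pd hU (hv _) γ)).integrable
  have j2 : ∀ i β γ σ, Integrable fun x =>
      pd γ (pd σ (fun y => dJet2 F i β γ σ (jet lam y))) x * η i β x := fun i β γ σ =>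
    ((hη i β).mul_left hU (contDiffOn_pd hU (contDiffOn_pd hU (hv _) σ) γ)).integrable
  have t1 : ∀ i β, Integrable fun x =>
      ∑ γ, pd γ (fun y => dJet1 F i β γ (jet lam y)) x * η i β x :=
    fun i β => integrable_finsetSum _ fun γ _ => j1 i β γ
  have t2 : ∀ i β, Integrable fun x =>
      ∑ γ, ∑ σ, pd γ (pd σ (fun y => dJet2 F i β γ σ (jet lam y))) x * η i β x :=
    fun i β => integrable_finsetSum _ fun γ _ => integrable_finsetSum _ fun σ _ => j2 i β γ σ
  change ∫ x, ∑ i, ∑ β, (dJet0 F i β (jet lam x) * η i β x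
      + ∑ γ, dJet1 F i β γ (jet lam x) * pd γ (η i β) x
      + ∑ γ, ∑ σ, dJet2 F i β γ σ (jet lam x) * pd σ (pd γ (η i β)) x) = _
  rw [integral_finsetSum _ fun i _ => integrable_finsetSum _ fun β _ =>
    ((i0 i β).fun_add (s1 i β)).fun_add (s2 i β)]
  refine Finset.sum_congr rfl fun i _ => ?_
  rw [integral_finsetSum _ fun β _ => ((i0 i β).fun_add (s1 i β)).fun_add (s2 i β)]
  refine Finset.sum_congr rfl fun β _ => ?_
  have hr : ∀ x, eulerLagrange F lam i β x * η i β x = dJet0 F i β (jet lam x) * η i β x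
      - ∑ γ, pd γ (fun y => dJet1 F i β γ (jet lam y)) x * η i β x
      + ∑ γ, ∑ σ, pd γ (pd σ (fun y => dJet2 F i β γ σ (jet lam y))) x * η i β x := by
    intro x
    simp only [eulerLagrange, add_mul, sub_mul, Finset.sum_mul]
  simp only [hr]
  rw [integral_add ((i0 i β).fun_add (s1 i β)) (s2 i β), integral_add (i0 i β) (s1 i β),
    integral_add (integrable_fun_sub (i0 i β) (t1 i β)) (t2 i β), integral_sub (i0 i β) (t1 i β),
    integral_finsetSum _ fun γ _ => i1 i β γ, integral_finsetSum _ fun γ _ => j1 i β γ,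
    integral_finsetSum _ fun γ _ => integrable_finsetSum _ fun σ _ => i2 i β γ σ,
    integral_finsetSum _ fun γ _ => integrable_finsetSum _ fun σ _ => j2 i β γ σ,
    sub_eq_add_neg, ← Finset.sum_neg_distrib]
  congr 1
  · congr 1
    exact Finset.sum_congr rfl fun γ _ => (hη i β).integral_mul_pd hU (hv _) γ
  · refine Finset.sum_congr rfl fun γ _ => ?_
    rw [integral_finsetSum _ fun σ _ => i2 i β γ σ, integral_finsetSum _ fun σ _ => j2 i β γ σ]
    refine Finset.sum_congr rfl fun σ _ => ?_
    -- Two integrations by parts, in σ and then in γ; the signs cancel.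
    have e1 := ((hη i β).pd γ).integral_mul_pd hU
      (hv (0, 0, Pi.single i (Pi.single β (Pi.single γ (Pi.single σ 1))))) σ
    have e2 := (hη i β).integral_mul_pd hU (contDiffOn_pd hU
      (hv (0, 0, Pi.single i (Pi.single β (Pi.single γ (Pi.single σ 1))))) σ) γ
    exact e1.trans (by rw [e2, neg_neg]; rfl)

end

lemma isTest_lieDeriv (hU : IsOpen U) (h : ∀ i μ, ContDiffOn ℝ ∞ (lam i μ) U) {ϕ : Coord n → ℝ}
    (hϕ : IsTest U ϕ) (a i μ : Fin n) : IsTest U (lieDeriv ϕ a lam i μ) := by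
  have := (hϕ.mul_left hU (contDiffOn_pd hU (h i μ) a)).add ((hϕ.pd μ).mul_left hU (h i a))
  convert this using 2 with x
  simp only [lieDeriv]
  ring

/-- Noether's second identity for the coordinate-invariant Lagrangian `L`. -/
theorem noether_identity (hD : IsOpen D) (hdet : ∀ J ∈ D, jetDet J ≠ 0)
    (hL : ContDiffOn ℝ ∞ L D) (hinv : CoordInvariant D L) (hU : IsOpen U)
    (h : ∀ i μ, ContDiffOn ℝ ∞ (lam i μ) U) (hdom : ∀ x ∈ U, jet lam x ∈ D) (a : Fin n)
    {x : Coord n} (hx : x ∈ U) :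
    ∑ i, ∑ β, pd β (fun y => eulerLagrange (density L) lam i β y * lam i a y) x =
      ∑ i, ∑ β, eulerLagrange (density L) lam i β x * pd a (lam i β) x := by
  have hF := contDiffOn_density hL
  have hP := contDiffOn_eulerLagrange hD hF hU h hdom
  have hPl : ∀ i β, ContDiffOn ℝ ∞ (fun y => eulerLagrange (density L) lam i β y * lam i a y) U :=
    fun i β => (hP i β).mul (h i a)
  have hPd : ∀ i β, ContDiffOn ℝ ∞
      (fun y => eulerLagrange (density L) lam i β y * pd a (lam i β) y) U :=
    fun i β => (hP i β).mul (contDiffOn_pd hU (h i β) a)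
  have key : ∀ y ∈ U, (∑ i, ∑ β, (eulerLagrange (density L) lam i β y * pd a (lam i β) y
      - pd β (fun y => eulerLagrange (density L) lam i β y * lam i a y) y)) = 0 := by
    refine eq_zero_of_integral_mul_test hU (ContDiffOn.sum fun i _ => ContDiffOn.sum fun β _ =>
      (hPd i β).sub (contDiffOn_pd hU (hPl i β) β)) fun ϕ hϕ => ?_
    have hη := isTest_lieDeriv hU h hϕ a
    have k1 : ∀ i β, Integrable fun y =>
        eulerLagrange (density L) lam i β y * pd a (lam i β) y * ϕ y := fun i β =>
      (hϕ.mul_left hU (hPd i β)).integrable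
    have k2 : ∀ i β, Integrable fun y =>
        pd β (fun y => eulerLagrange (density L) lam i β y * lam i a y) y * ϕ y := fun i β =>
      (hϕ.mul_left hU (contDiffOn_pd hU (hPl i β) β)).integrable
    have k3 : ∀ i β, Integrable fun y =>
        eulerLagrange (density L) lam i β y * lam i a y * pd β ϕ y := fun i β =>
      ((hϕ.pd β).mul_left hU (hPl i β)).integrable
    -- The variation is the a-derivative of a compactly supported function.
    have hvar : ∫ y, fderiv ℝ (density L) (jet lam y) (jet (lieDeriv ϕ a lam) y) = 0 := by
      have hT : IsTest U fun y => density L (jet lam y) * ϕ y := hϕ.mul_left hU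
        (hF.comp (contDiffOn_jet hU h) fun y hy => hdom y hy)
      rw [← hT.integral_pd a]
      congr 1
      funext y
      by_cases hy : y ∈ U
      · exact fderiv_density_lieDeriv hD hdet hL hinv hϕ.smooth a hU h hdom hy
      -- Outside `U` invariance says nothing, but there both sides vanish by the support condition.
      · have : jet (lieDeriv ϕ a lam) y = 0 := by
          refine Prod.ext ?_ (Prod.ext ?_ ?_)
          · funext i μ
            exact (hη i μ).eq_zero hy
          · funext i μ ν
            exact ((hη i μ).pd ν).eq_zero hy
          · funext i μ ν σ
            exact (((hη i μ).pd ν).pd σ).eq_zero hy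
        rw [this, map_zero, (hT.pd a).eq_zero hy]
    rw [integral_fderiv_jet hD hF hU h hdom hη] at hvar
    rw [← hvar]
    simp only [Finset.sum_mul, sub_mul]
    rw [integral_finsetSum _ fun i _ => integrable_finsetSum _ fun β _ => integrable_fun_sub (k1 i β) (k2 i β)]
    refine Finset.sum_congr rfl fun i _ => ?_
    rw [integral_finsetSum _ fun β _ => integrable_fun_sub (k1 i β) (k2 i β)]
    refine Finset.sum_congr rfl fun β _ => ?_
    -- Moving the derivative back onto ϕ reassembles the Lie derivative of the tetrad.
    rw [integral_sub (k1 i β) (k2 i β), sub_eq_add_neg, ← hϕ.integral_mul_pd hU (hPl i β) β,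
      ← integral_add (k1 i β) (k3 i β)]
    congr 1
    funext y
    simp only [lieDeriv]
    ring
  have := key x hx
  simp only [Finset.sum_sub_distrib] at this
  linarith

end

/-! ### The parameterized absolute parallelism connections -/

section

variable {lam : Tetrad n} {U : Set (Coord n)} {x : Coord n}

lemma matrix_metric (lam : Tetrad n) (x : Coord n) :
    (Matrix.of fun α β => metric lam α β x) =
      (Matrix.of fun j ν => lam j ν x).transpose * Matrix.of fun j ν => lam j ν x := by
  ext α β
  simp [Matrix.mul_apply, metric]

lemma metricInv_eq (lam : Tetrad n) (μ ν : Fin n) (x : Coord n) :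
    metricInv lam μ ν x = ∑ i, contra lam i μ x * contra lam i ν x := by
  rw [metricInv, matrix_metric, Matrix.mul_inv_rev, ← Matrix.transpose_nonsing_inv,
    Matrix.mul_apply]
  rfl

lemma metricInv_symm (lam : Tetrad n) (μ ν : Fin n) (x : Coord n) :
    metricInv lam μ ν x = metricInv lam ν μ x := by
  simp only [metricInv_eq, mul_comm]

lemma sum_metricInv_mul_metric (hdet : jetDet (jet lam x) ≠ 0) (β κ : Fin n) :
    ∑ α, metricInv lam α β x * metric lam α κ x = if β = κ then 1 else 0 := by
  have hu : IsUnit (Matrix.of fun α β => metric lam α β x).det := by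
    rw [matrix_metric, Matrix.det_mul, Matrix.det_transpose]
    exact isUnit_iff_ne_zero.2 (mul_ne_zero hdet hdet)
  have h := congrFun (congrFun (Matrix.nonsing_inv_mul _ hu) β) κ
  simp only [metricInv_symm lam _ β]
  simpa [Matrix.mul_apply, Matrix.one_apply, metricInv] using h

lemma pd_metric (hU : IsOpen U) (h : ∀ i μ, ContDiffOn ℝ ∞ (lam i μ) U) (hx : x ∈ U)
    (μ ν σ : Fin n) :
    pd σ (metric lam μ ν) x =
      ∑ i, (pd σ (lam i μ) x * lam i ν x + lam i μ x * pd σ (lam i ν) x) := by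
  have hd := fun i μ => differentiableAt_of_contDiffOn hU (h i μ) hx
  change pd σ (fun y => ∑ i, lam i μ y * lam i ν y) x = _
  rw [pd_sum _ fun i _ => (hd i μ).fun_mul (hd i ν)]
  exact Finset.sum_congr rfl fun i _ => pd_mul (hd i μ) (hd i ν) σ

/-- Raising the coordinate index of the dual forms gives the frame: g^{ασ} λ_{iσ} = λ_i^α. -/
lemma sum_contra_metric (hdet : jetDet (jet lam x) ≠ 0) (f : Fin n → Fin n → ℝ) :
    ∑ α, ∑ σ, metricInv lam α σ x * ∑ i, lam i σ x * f i α =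
      ∑ i, ∑ α, contra lam i α x * f i α := by
  rw [Finset.sum_comm (f := fun i α => contra lam i α x * f i α)]
  refine Finset.sum_congr rfl fun α _ => ?_
  simp only [metricInv_eq, Finset.mul_sum, Finset.sum_mul]
  rw [Finset.sum_comm]
  have : ∀ i, ∑ σ, ∑ j, contra lam j α x * contra lam j σ x * (lam i σ x * f i α) =
      ∑ j, contra lam j α x * f i α * ∑ σ, lam i σ x * contra lam j σ x := fun i => by
    simp only [Finset.mul_sum]
    rw [Finset.sum_comm]
    exact Finset.sum_congr rfl fun j _ => Finset.sum_congr rfl fun σ _ => by ring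
  simp [this, sum_mul_contra hdet]

lemma sum_weitzenbock_self (hU : IsOpen U) (h : ∀ i μ, ContDiffOn ℝ ∞ (lam i μ) U) (hx : x ∈ U)
    (hdet : jetDet (jet lam x) ≠ 0) (ν : Fin n) :
    jetDet (jet lam x) * ∑ α, weitzenbock lam α α ν x = pd ν (fun y => jetDet (jet lam y)) x := by
  rw [pd_jetDet hU h hx hdet, Finset.sum_comm]
  rfl

/-- In the trace, two of the three Christoffel terms cancel by symmetry, leaving ½ g^{ασ} g_{ασ,ν}.
The product rule for g_{ασ} yields the Weitzenböck trace twice. -/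
lemma sum_christoffel_self (hU : IsOpen U) (h : ∀ i μ, ContDiffOn ℝ ∞ (lam i μ) U) (hx : x ∈ U)
    (hdet : jetDet (jet lam x) ≠ 0) (ν : Fin n) :
    ∑ α, christoffel lam α α ν x = ∑ α, weitzenbock lam α α ν x := by
  have e1 : ∑ α, ∑ σ, metricInv lam α σ x * pd ν (metric lam α σ) x =
      2 * ∑ α, weitzenbock lam α α ν x := by
    have k1 : ∑ α, ∑ σ, metricInv lam α σ x * ∑ i, lam i σ x * pd ν (lam i α) x =
        ∑ α, weitzenbock lam α α ν x := by
      rw [sum_contra_metric hdet fun i α => pd ν (lam i α) x, Finset.sum_comm]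
      rfl
    have k2 : ∑ α, ∑ σ, metricInv lam α σ x * ∑ i, lam i α x * pd ν (lam i σ) x =
        ∑ α, weitzenbock lam α α ν x := by
      rw [← k1, Finset.sum_comm]
      simp only [metricInv_symm]
    rw [two_mul]
    nth_rw 1 [← k1]
    rw [← k2, ← Finset.sum_add_distrib]
    refine Finset.sum_congr rfl fun α _ => ?_
    rw [← Finset.sum_add_distrib]
    refine Finset.sum_congr rfl fun σ _ => ?_
    rw [pd_metric hU h hx, Finset.sum_add_distrib, mul_add]
    simp only [mul_comm]
  have e2 : ∑ α, ∑ σ, metricInv lam α σ x * pd α (metric lam ν σ) x =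
      ∑ α, ∑ σ, metricInv lam α σ x * pd σ (metric lam α ν) x := by
    rw [Finset.sum_comm]
    refine Finset.sum_congr rfl fun α _ => Finset.sum_congr rfl fun σ _ => ?_
    rw [metricInv_symm, show metric lam ν α = metric lam α ν from
      funext fun y => by simp only [metric, mul_comm]]
  simp only [christoffel, ← Finset.mul_sum, mul_add, mul_sub, Finset.sum_add_distrib,
    Finset.sum_sub_distrib, e1, e2]
  ring

/-- The contortion has zero trace in its first two indices, so b drops out. -/
lemma sum_conn_self (hU : IsOpen U) (h : ∀ i μ, ContDiffOn ℝ ∞ (lam i μ) U) (hx : x ∈ U)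
    (hdet : jetDet (jet lam x) ≠ 0) (b : ℝ) (ν : Fin n) :
    jetDet (jet lam x) * ∑ α, conn b lam α α ν x = pd ν (fun y => jetDet (jet lam y)) x := by
  rw [← sum_weitzenbock_self hU h hx hdet]
  simp only [conn, contortion, Finset.sum_add_distrib, ← Finset.mul_sum, Finset.sum_sub_distrib,
    sum_christoffel_self hU h hx hdet]
  ring

lemma pd_tetrad_eq (hdet : jetDet (jet lam x) ≠ 0) (i μ ν : Fin n) :
    pd ν (lam i μ) x = ∑ α, lam i α x * weitzenbock lam α μ ν x := by
  have : ∑ α, lam i α x * weitzenbock lam α μ ν x =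
      ∑ j, (∑ α, lam i α x * contra lam j α x) * pd ν (lam j μ) x := by
    simp only [weitzenbock, Finset.mul_sum, Finset.sum_mul]
    rw [Finset.sum_comm]
    exact Finset.sum_congr rfl fun j _ => Finset.sum_congr rfl fun σ _ => by ring
  simp [this, sum_mul_contra hdet]

/-- The tetrad is parallel at b = 1, where the connection is Weitzenböck's; in general the
connection differs from that one by (1-b) times the contortion. -/
lemma covPlus_tetrad (hdet : jetDet (jet lam x) ≠ 0) (b : ℝ) (i μ ν : Fin n) :
    covPlus b lam (lam i) μ ν x = (1 - b) * ∑ α, lam i α x * contortion lam α μ ν x := by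
  rw [covPlus, pd_tetrad_eq hdet, ← Finset.sum_sub_distrib, Finset.mul_sum]
  refine Finset.sum_congr rfl fun α _ => ?_
  simp only [conn, contortion]
  ring

lemma sum_fieldEUp_mul_contortionLow (L : Jet n → ℝ) (hdet : jetDet (jet lam x) ≠ 0)
    (μ ν : Fin n) :
    ∑ α, fieldEUp L lam μ α x * contortionLow lam α μ ν x =
      ∑ α, fieldE L lam μ α x * contortion lam α μ ν x := by
  have : ∑ α, fieldEUp L lam μ α x * contortionLow lam α μ ν x =
      ∑ β, ∑ κ, fieldE L lam μ β x * contortion lam κ μ ν x *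
        ∑ α, metricInv lam α β x * metric lam α κ x := by
    simp only [fieldEUp, contortionLow, Finset.sum_mul_sum]
    simp only [Finset.mul_sum]
    rw [Finset.sum_comm]
    refine Finset.sum_congr rfl fun β _ => ?_
    rw [Finset.sum_comm]
    exact Finset.sum_congr rfl fun j _ => Finset.sum_congr rfl fun σ _ => by ring
  simp [this, sum_metricInv_mul_metric hdet]

lemma sum_covPlus_mul_fieldJ (L : Jet n → ℝ) (hdet : jetDet (jet lam x) ≠ 0) (b : ℝ)
    (ν : Fin n) :
    ∑ i, ∑ μ, covPlus b lam (lam i) μ ν x * fieldJ L lam i μ x =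
      -((1 - b) * ∑ μ, ∑ α, fieldE L lam μ α x * contortion lam α μ ν x) := by
  rw [Finset.sum_comm, Finset.mul_sum, ← Finset.sum_neg_distrib]
  refine Finset.sum_congr rfl fun μ _ => ?_
  simp only [covPlus_tetrad hdet, fieldJ, fieldE, Finset.mul_sum, Finset.sum_mul,
    ← Finset.sum_neg_distrib]
  rw [Finset.sum_comm]
  exact Finset.sum_congr rfl fun j _ => Finset.sum_congr rfl fun σ _ => by ring

end

/-! ### The differential identity in coordinates -/

section

variable {lam : Tetrad n} {U : Set (Coord n)} {D : Set (Jet n)} {L : Jet n → ℝ} {x : Coord n}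

lemma jetDet_mul_hamiltonDeriv (L : Jet n → ℝ) (hdet : jetDet (jet lam x) ≠ 0) (i β : Fin n) :
    jetDet (jet lam x) * hamiltonDeriv L lam i β x = eulerLagrange (density L) lam i β x := by
  rw [hamiltonDeriv, ← mul_assoc, mul_one_div_cancel hdet, one_mul]
  rfl

lemma jetDet_mul_fieldE (L : Jet n → ℝ) (hdet : jetDet (jet lam x) ≠ 0) (μ ν : Fin n) :
    jetDet (jet lam x) * fieldE L lam μ ν x =
      ∑ i, eulerLagrange (density L) lam i μ x * lam i ν x := by
  rw [fieldE, Finset.mul_sum]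
  refine Finset.sum_congr rfl fun i _ => ?_
  rw [← mul_assoc, jetDet_mul_hamiltonDeriv L hdet]

/-- The Noether identity divided by λ: the term E^μ_ν ∂_μ λ / λ is rewritten through the connection
trace. -/
lemma divergence_fieldE (hD : IsOpen D) (hdet : ∀ J ∈ D, jetDet J ≠ 0)
    (hL : ContDiffOn ℝ ∞ L D) (hinv : CoordInvariant D L) (hU : IsOpen U)
    (h : ∀ i μ, ContDiffOn ℝ ∞ (lam i μ) U) (hdom : ∀ x ∈ U, jet lam x ∈ D) (hx : x ∈ U)
    (b : ℝ) (ν : Fin n) :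
    ∑ μ, pd μ (fieldE L lam μ ν) x + ∑ μ, fieldE L lam μ ν x * ∑ α, conn b lam α α μ x =
      ∑ i, ∑ μ, hamiltonDeriv L lam i μ x * pd ν (lam i μ) x := by
  have hne : ∀ y ∈ U, jetDet (jet lam y) ≠ 0 := fun y hy => hdet _ (hdom y hy)
  have hP := contDiffOn_eulerLagrange hD (contDiffOn_density hL) hU h hdom
  have hPl : ∀ i μ, DifferentiableAt ℝ
      (fun y => eulerLagrange (density L) lam i μ y * lam i ν y) x := fun i μ =>
    differentiableAt_of_contDiffOn hU ((hP i μ).mul (h i ν)) hx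
  have hdetS : ContDiffOn ℝ ∞ (fun y => jetDet (jet lam y)) U :=
    contDiff_jetDet.comp_contDiffOn (contDiffOn_jet hU h)
  have hE : ∀ μ, ContDiffOn ℝ ∞ (fieldE L lam μ ν) U := fun μ =>
    ((hdetS.inv hne).mul (ContDiffOn.sum fun i _ => (hP i μ).mul (h i ν))).congr fun y hy => by
      change _ = (jetDet (jet lam y))⁻¹ * ∑ i, eulerLagrange (density L) lam i μ y * lam i ν y
      rw [← jetDet_mul_fieldE L (hne y hy), inv_mul_cancel_left₀ (hne y hy)]
  have e : ∀ μ, ∑ i, pd μ (fun y => eulerLagrange (density L) lam i μ y * lam i ν y) x =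
      jetDet (jet lam x) * (pd μ (fieldE L lam μ ν) x
        + fieldE L lam μ ν x * ∑ α, conn b lam α α μ x) := fun μ => by
    rw [← pd_sum _ fun i _ => hPl i μ]
    have hc : (fun y => ∑ i, eulerLagrange (density L) lam i μ y * lam i ν y) =ᶠ[𝓝 x]
        fun y => jetDet (jet lam y) * fieldE L lam μ ν y := by
      filter_upwards [hU.mem_nhds hx] with y hy using (jetDet_mul_fieldE L (hne y hy) μ ν).symm
    rw [pd_congr hc, pd_mul (differentiableAt_of_contDiffOn hU hdetS hx)
      (differentiableAt_of_contDiffOn hU (hE μ) hx), ← sum_conn_self hU h hx (hne x hx) b]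
    ring
  have hN := noether_identity hD hdet hL hinv hU h hdom ν hx
  rw [Finset.sum_comm] at hN
  simp only [e, ← jetDet_mul_hamiltonDeriv L (hne x hx), mul_assoc, ← Finset.mul_sum] at hN
  rw [← Finset.sum_add_distrib]
  exact mul_left_cancel₀ (hne x hx) hN

/-- Transposing the connection puts the contracted index where the trace formula applies, so the
first correction completes the divergence. The second, E^μ_α ∇^α_{μν}, is exactly the connection
term of λ_{iμ‖+ν} J_i^μ. -/
theorem sum_covMinus_fieldE (hD : IsOpen D) (hdet : ∀ J ∈ D, jetDet J ≠ 0)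
    (hL : ContDiffOn ℝ ∞ L D) (hinv : CoordInvariant D L) (hU : IsOpen U)
    (h : ∀ i μ, ContDiffOn ℝ ∞ (lam i μ) U) (hdom : ∀ x ∈ U, jet lam x ∈ D) (hx : x ∈ U)
    (b : ℝ) (ν : Fin n) :
    ∑ μ, covMinus b lam (fieldE L lam) μ ν μ x =
      (1 - b) * ∑ μ, ∑ α, fieldE L lam μ α x * contortion lam α μ ν x := by
  have hne : jetDet (jet lam x) ≠ 0 := hdet _ (hdom x hx)
  have h1 := divergence_fieldE hD hdet hL hinv hU h hdom hx b ν
  have h2 := sum_covPlus_mul_fieldJ L hne b ν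
  have h3 : ∑ i, ∑ μ, covPlus b lam (lam i) μ ν x * fieldJ L lam i μ x =
      ∑ μ, ∑ α, fieldE L lam μ α x * conn b lam α μ ν x
        - ∑ i, ∑ μ, hamiltonDeriv L lam i μ x * pd ν (lam i μ) x := by
    have : ∑ μ, ∑ α, fieldE L lam μ α x * conn b lam α μ ν x =
        ∑ i, ∑ μ, hamiltonDeriv L lam i μ x * ∑ α, lam i α x * conn b lam α μ ν x := by
      rw [Finset.sum_comm (f := fun i μ => hamiltonDeriv L lam i μ x *
        ∑ α, lam i α x * conn b lam α μ ν x)]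
      refine Finset.sum_congr rfl fun μ _ => ?_
      simp only [fieldE, Finset.sum_mul, Finset.mul_sum]
      rw [Finset.sum_comm]
      exact Finset.sum_congr rfl fun j _ => Finset.sum_congr rfl fun σ _ => by ring
    rw [this, ← Finset.sum_sub_distrib]
    refine Finset.sum_congr rfl fun i _ => ?_
    rw [← Finset.sum_sub_distrib]
    refine Finset.sum_congr rfl fun μ _ => ?_
    rw [covPlus, fieldJ]
    ring
  have h4 : ∑ μ, ∑ α, fieldE L lam α ν x * conn b lam μ μ α x =
      ∑ μ, fieldE L lam μ ν x * ∑ α, conn b lam α α μ x := by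
    rw [Finset.sum_comm]
    simp only [Finset.mul_sum]
  simp only [covMinus, connDual, Finset.sum_add_distrib, Finset.sum_sub_distrib]
  linarith

end

/-! ### Smoothness of the tetrad in a chart -/

section

variable {M : Type*} [TopologicalSpace M] [ChartedSpace (Coord n) M] [IsManifold (𝓡 n) ∞ M]
  {X : Fin n → (p : M) → TangentSpace (𝓡 n) p} {φ : OpenPartialHomeomorph M (Coord n)}

/-- The components are the fibre part of the tangent map of φ applied to the smooth section X ∘ φ⁻¹.
-/
lemma contDiffOn_frameComp (hX : IsParallelization X)
    (hφ : φ ∈ IsManifold.maximalAtlas (𝓡 n) ∞ M) (i μ : Fin n) :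
    ContDiffOn ℝ ∞ (frameComp X φ i μ) φ.target := by
  have h1 : ContMDiffOn (𝓡 n) (𝓡 n) ∞ φ φ.source := contMDiffOn_of_mem_maximalAtlas hφ
  have h2 : ContMDiffOn (𝓡 n) (𝓡 n) ∞ φ.symm φ.target := contMDiffOn_symm_of_mem_maximalAtlas hφ
  have h3 := h1.contMDiffOn_tangentMapWithin (m := ∞) (by simp) φ.open_source.uniqueMDiffOn
  have h4 : ContMDiffOn (𝓡 n) (𝓡 n).tangent ∞
      (fun x => (⟨φ.symm x, X i (φ.symm x)⟩ : TangentBundle (𝓡 n) M)) φ.target :=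
    (hX.smooth i).comp_contMDiffOn h2
  have h5 := h3.comp h4 fun x hx => φ.map_target hx
  have h6 := (contMDiff_snd_tangentBundle_modelSpace (Coord n) (𝓡 n) (n := ∞)).comp_contMDiffOn h5
  have h7 := h6.contDiffOn
  have h8 : ContDiffOn ℝ ∞ (fun x => (show Coord n from
      mfderiv (𝓡 n) (𝓡 n) φ (φ.symm x) (X i (φ.symm x)))) φ.target := by
    refine h7.congr fun x hx => ?_
    exact congrArg (fun l => l (X i (φ.symm x)))
      (mfderivWithin_of_isOpen (I := 𝓡 n) (I' := 𝓡 n) (f := φ) φ.open_source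
        (φ.map_target hx)).symm
  exact (EuclideanSpace.proj (𝕜 := ℝ) μ).contDiff.comp_contDiffOn h8

lemma contDiffOn_tetrad (hX : IsParallelization X)
    (hφ : φ ∈ IsManifold.maximalAtlas (𝓡 n) ∞ M)
    (hdet : ∀ x ∈ φ.target, jetDet (jet (tetrad X φ) x) ≠ 0) (i μ : Fin n) :
    ContDiffOn ℝ ∞ (tetrad X φ i μ) φ.target := by
  refine contDiffOn_inv_apply (fun j ν => contDiffOn_frameComp hX hφ j ν) (fun x hx h0 => ?_) μ i
  -- A singular frame matrix would have, by the convention for inverses, an inverse of determinant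
  -- zero, contradicting the nondegeneracy of the tetrad.
  have h1 : (Matrix.of fun j ν => tetrad X φ j ν x) =
      ((Matrix.of fun j ν => frameComp X φ j ν x)⁻¹).transpose := rfl
  have h2 : (Matrix.of fun j ν => tetrad X φ j ν x).det ≠ 0 := hdet x hx
  rw [h1, Matrix.det_transpose, Matrix.det_nonsing_inv, h0] at h2
  simp at h2

end

end PAP

theorem mainTheorem1 {n : ℕ} {M : Type*} [TopologicalSpace M] [ChartedSpace (PAP.Coord n) M]
    [IsManifold (𝓡 n) ∞ M]
    (X : Fin n → (p : M) → TangentSpace (𝓡 n) p) (hX : PAP.IsParallelization X)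
    (D : Set (PAP.Jet n)) (hD : IsOpen D) (hdet : ∀ J ∈ D, PAP.jetDet J ≠ 0)
    (L : PAP.Jet n → ℝ) (hL : ContDiffOn ℝ ∞ L D) (hinv : PAP.CoordInvariant D L)
    (b : ℝ)
    (φ : OpenPartialHomeomorph M (PAP.Coord n))
    (hφ : φ ∈ IsManifold.maximalAtlas (𝓡 n) ∞ M)
    (hdom : ∀ x ∈ φ.target, PAP.jet (PAP.tetrad X φ) x ∈ D) :
    ∀ x ∈ φ.target, ∀ ν : Fin n,
      (∑ μ, PAP.covMinus b (PAP.tetrad X φ) (PAP.fieldE L (PAP.tetrad X φ)) μ ν μ x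
        + ∑ i, ∑ μ, PAP.covPlus b (PAP.tetrad X φ) (PAP.tetrad X φ i) μ ν x
            * PAP.fieldJ L (PAP.tetrad X φ) i μ x = 0) ∧
      (∑ μ, PAP.covMinus b (PAP.tetrad X φ) (PAP.fieldE L (PAP.tetrad X φ)) μ ν μ x
        = (1 - b) * ∑ μ, ∑ α, PAP.fieldEUp L (PAP.tetrad X φ) μ α x
            * PAP.contortionLow (PAP.tetrad X φ) α μ ν x) := by
  intro x hx ν
  have hne : ∀ y ∈ φ.target, PAP.jetDet (PAP.jet (PAP.tetrad X φ) y) ≠ 0 := fun y hy =>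
    hdet _ (hdom y hy)
  have key := PAP.sum_covMinus_fieldE hD hdet hL hinv φ.open_target
    (PAP.contDiffOn_tetrad hX hφ hne) hdom hx b ν
  refine ⟨?_, ?_⟩
  · rw [key, PAP.sum_covPlus_mul_fieldJ L (hne x hx), add_neg_cancel]
  · simp only [PAP.sum_fieldEUp_mul_contortionLow L (hne x hx), key]
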